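/- Let $\mathcal H$ be a Hilbert space with norm $|\cdot|$. (1) Let $Y_1,Y_2,\ldots$ be i.i.d. real random variables with $\mathbb E Y_1^2=1$ and $\mathrm{Var}(Y_1^2)<\infty$, let $(e_i)_{i\ge 1}$ be an orthonormal sequence in $\mathcal H$, and put $S_k=\sum_{i=1}^k Y_ie_i$. Then for every $t>0$ and every $k\ge 1$, $$\mathbb P\big(\big||S_k|-\sqrt k\big|\ge t\big)\le \frac{\mathrm{Var}(Y_1^2)}{t^2}.$$ If moreover $\mathrm{Var}(Y_1^2)>0$, then for every $t>0$, $$\lim_{n\to\infty}\mathbb P\Big(\max_{1\le k\le n}\big||S_k|-\sqrt k\big|\ge t\Big)=1.$$ (2) Suppose that $\mathcal H$ is infinite-dimensional. Then for all real constants $C_1,C_2$ there exist independent, identically distributed, symmetric random vectors $X_1,X_2,\ldots$ with values in $\mathcal H$, an integer $n\ge 1$, real numbers $a_1,\ldots,a_n$ and $t>0$ such that, with $S_k=\sum_{i=1}^k X_i$, $$\mathbb P\Big(\max_{1\le k\le n}\big||S_k|-a_k\big|>C_1t\Big)>C_2\max_{1\le k\le n}\mathbb P\big(\big||S_k|-a_k\big|>t\big).$$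 In particular, the inequality $\mathbb P(\max_{1\le k\le n}||S_k|-a_k|>11t)\le 30\max_{1\le k\le n}\mathbb P(||S_k|-a_k|>t)$, which is valid for all independent real random variables, all real $a_k$ and all $t>0$, fails in every infinite-dimensional Hilbert space, even for symmetric and identically distributed summands. -/

import Mathlib

open MeasureTheory ProbabilityTheory Filter Topology

/-- The partial sum `S_k = X_1 + ... + X_k` of a sequence of random vectors. The terms of the
sequence are numbered from `0` here, so `S_k` is the sum of the first `k` of them. -/
def partialSum {Ω H : Type*} [AddCommMonoid H] (X : ℕ → Ω → H) (k : ℕ) (ω : Ω) : H :=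
  ∑ i ∈ Finset.range k, X i ω

/-- `max_{1 ≤ k ≤ n} f k` for `n ≥ 1` (and `0` for `n = 0`, where there is no such maximum). -/
noncomputable def maxUpTo (n : ℕ) (f : ℕ → ℝ) : ℝ :=
  if h : 1 ≤ n then (Finset.Icc 1 n).sup' (Finset.nonempty_Icc.2 h) f else 0

theorem le_maxUpTo_iff {n : ℕ} (hn : 1 ≤ n) (f : ℕ → ℝ) (t : ℝ) :
    t ≤ maxUpTo n f ↔ ∃ k ∈ Finset.Icc 1 n, t ≤ f k := by
  simp only [maxUpTo, dif_pos hn, Finset.le_sup'_iff]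

theorem lt_maxUpTo_iff {n : ℕ} (hn : 1 ≤ n) (f : ℕ → ℝ) (t : ℝ) :
    t < maxUpTo n f ↔ ∃ k ∈ Finset.Icc 1 n, t < f k := by
  simp only [maxUpTo, dif_pos hn, Finset.lt_sup'_iff]

/-- A random vector is symmetric if it has the same law as its negative. -/
def IsSymmetricRV {Ω H : Type*} [MeasurableSpace Ω] [MeasurableSpace H] [Neg H]
    (X : Ω → H) (μ : Measure Ω) : Prop :=
  IdentDistrib X (fun ω => -X ω) μ μ

/-! For orthonormal `e i`, `‖S_k‖ ^ 2` is the sum of the `Y i ^ 2`, so `‖S_k‖ - √k` times `‖S_k‖ +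
√k` is the centred walk with steps `Y i ^ 2 - 1`. The second factor is at least `√k`, and Chebyshev
bounds each single deviation uniformly in `k`. If all deviations up to `n` are at most `t`, the walk
stays within `t * (t + 2) * √k`. This has vanishing probability
(`tendsto_measureReal_forall_abs_sum_le`): each doubling of time costs a fixed factor below 1, by
the central limit theorem on the new block.

For identically distributed summands the direction is randomised: `X i` is a Gaussian multiple of `e
u`, with `u` uniform below `N`. Once `n` is fixed, a large `N` makes the first `n` directions
distinct with high probability, and then the norms are those of the orthonormal example. -/

/-! ### Centred random walks leave every `√k` barrier. -/

/-- By the central limit theorem, the centred partial sums exceed `K √m` with a probability that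
stays bounded away from `0`. -/
theorem exists_pos_eventually_le_measureReal_sum_gt {Ω : Type*} [MeasurableSpace Ω]
    {μ : Measure Ω} [IsProbabilityMeasure μ] {Z : ℕ → Ω → ℝ} (hind : iIndepFun Z μ)
    (hid : ∀ i, IdentDistrib (Z i) (Z 0) μ μ) (hL : MemLp (Z 0) 2 μ) (hmean : ∫ ω, Z 0 ω ∂μ = 0)
    (hvar : 0 < variance (Z 0) μ) (K : ℝ) :
    ∃ δ : ℝ, 0 < δ ∧
      ∀ᶠ m : ℕ in atTop, δ ≤ μ.real {ω | K * √(m : ℝ) < ∑ i ∈ Finset.range m, Z i ω} := by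
  set v : NNReal := (variance (Z 0) μ).toNNReal with hv
  have hclt := tendstoInDistribution_inv_sqrt_mul_sum_sub (HasLaw.id (μ := gaussianReal 0 v))
    hL hind hid
  have hlim := ProbabilityMeasure.le_liminf_measure_open_of_tendsto hclt.tendsto
    (isOpen_Ioi (a := K))
  have hv0 : v ≠ 0 := by simpa [hv] using hvar
  have hpos : 0 < gaussianReal 0 v (Set.Ioi K) := by
    refine pos_iff_ne_zero.2 fun h => ?_
    have := gaussianReal_absolutelyContinuous' 0 hv0 h
    simp at this
  obtain ⟨δ, hδ0, hδ⟩ := ENNReal.lt_iff_exists_real_btwn.1 hpos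
  have hδ1 := hδ.1
  have hδ2 : ENNReal.ofReal δ < _ := hδ.2.trans_le (by simpa using hlim)
  refine ⟨δ, by simpa using hδ1, ?_⟩
  filter_upwards [eventually_lt_of_lt_liminf hδ2, eventually_gt_atTop 0] with m hm hm0
  have hs : 0 < √(m : ℝ) := by positivity
  rw [Measure.map_apply_of_aemeasurable (hclt.forall_aemeasurable m) measurableSet_Ioi] at hm
  have hset : (fun ω => (√(m : ℝ))⁻¹ * (∑ i ∈ Finset.range m, Z i ω - m * ∫ ω, Z 0 ω ∂μ)) ⁻¹'
      Set.Ioi K = {ω | K * √(m : ℝ) < ∑ i ∈ Finset.range m, Z i ω} := by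
    ext ω
    simp only [hmean, mul_zero, sub_zero, Set.mem_preimage, Set.mem_Ioi, Set.mem_ofPred_eq]
    rw [inv_mul_eq_div, lt_div_iff₀ hs]
  rw [hset] at hm
  exact (ENNReal.ofReal_le_iff_le_toReal (measure_ne_top _ _)).1 hm.le

/-- If the first `2 m` partial sums stay within `M √k` of `0`, then so do the first `m` of them and
the independent increment over the second block is at most `3 M √m`. -/
theorem measureReal_forall_abs_sum_le_two_mul {Ω : Type*} [MeasurableSpace Ω]
    {μ : Measure Ω} [IsProbabilityMeasure μ] {Z : ℕ → Ω → ℝ} (hind : iIndepFun Z μ)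
    (hid : ∀ i, IdentDistrib (Z i) (Z 0) μ μ) {M : ℝ} (hM : 0 ≤ M) {m : ℕ} (hm : 1 ≤ m) :
    μ.real {ω | ∀ k ∈ Finset.Icc 1 (2 * m), |∑ i ∈ Finset.range k, Z i ω| ≤ M * √(k : ℝ)} ≤
      μ.real {ω | ∀ k ∈ Finset.Icc 1 m, |∑ i ∈ Finset.range k, Z i ω| ≤ M * √(k : ℝ)} *
        (1 - μ.real {ω | 3 * M * √(m : ℝ) < ∑ i ∈ Finset.range m, Z i ω}) := by
  have hmeas i : AEMeasurable (Z i) μ := (hid i).aemeasurable_fst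
  let s : Set (Finset.range m → ℝ) := {z | ∀ k ∈ Finset.Icc 1 m,
    |∑ i ∈ Finset.range k, (if h : i ∈ Finset.range m then z ⟨i, h⟩ else 0)| ≤ M * √(k : ℝ)}
  let t : Set (Finset.Ico m (2 * m) → ℝ) := {z | ∑ i, z i ≤ 3 * M * √(m : ℝ)}
  have hs : MeasurableSet s := by
    have : s = ⋂ k ∈ Finset.Icc 1 m, {z | |∑ i ∈ Finset.range k,
        (if h : i ∈ Finset.range m then z ⟨i, h⟩ else 0)| ≤ M * √(k : ℝ)} := by
      ext z; simp [s]
    rw [this]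
    refine Finset.measurableSet_biInter _ fun k _ => measurableSet_le ?_ measurable_const
    refine measurable_abs.comp (Finset.measurable_fun_sum _ fun i _ => ?_)
    split_ifs with h
    · exact measurable_pi_apply _
    · exact measurable_const
  have ht : MeasurableSet t :=
    measurableSet_le (Finset.measurable_fun_sum _ fun i _ => measurable_pi_apply _) measurable_const
  have hdisj : Disjoint (Finset.range m) (Finset.Ico m (2 * m)) := by
    rw [Finset.disjoint_left]
    intro i hi hi'
    simp only [Finset.mem_range, Finset.mem_Ico] at hi hi'
    omega
  have hmul := (hind.indepFun_finset₀ _ _ hdisj hmeas).measure_inter_preimage_eq_mul s t hs ht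
  have hS : (fun ω (i : Finset.range m) => Z i ω) ⁻¹' s =
      {ω | ∀ k ∈ Finset.Icc 1 m, |∑ i ∈ Finset.range k, Z i ω| ≤ M * √(k : ℝ)} := by
    ext ω
    simp only [s, Set.mem_preimage, Set.mem_ofPred_eq]
    refine forall₂_congr fun k hk => ?_
    rw [Finset.sum_congr rfl fun i hi => dif_pos (Finset.mem_range.2
      ((Finset.mem_range.1 hi).trans_le (Finset.mem_Icc.1 hk).2))]
  have hT : (fun ω (i : Finset.Ico m (2 * m)) => Z i ω) ⁻¹' t =
      {ω | ∑ i ∈ Finset.range m, Z (m + i) ω ≤ 3 * M * √(m : ℝ)} := by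
    ext ω
    simp only [t, Set.mem_preimage, Set.mem_ofPred_eq]
    rw [Finset.sum_coe_sort (Finset.Ico m (2 * m)) (fun i => Z i ω), Finset.sum_Ico_eq_sum_range,
      two_mul, Nat.add_sub_cancel]
  have hshift : IdentDistrib (fun ω i => Z (m + i) ω) (fun ω i => Z i ω) μ μ :=
    IdentDistrib.pi (fun i => (hid _).trans (hid i).symm)
      (hind.precomp (g := fun i => m + i) (add_right_injective m)) hind
  have hU : MeasurableSet {z : ℕ → ℝ | ∑ i ∈ Finset.range m, z i ≤ 3 * M * √(m : ℝ)} :=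
    measurableSet_le (Finset.measurable_fun_sum _ fun i _ => measurable_pi_apply _) measurable_const
  have hTlaw : μ.real {ω | ∑ i ∈ Finset.range m, Z (m + i) ω ≤ 3 * M * √(m : ℝ)} =
      1 - μ.real {ω | 3 * M * √(m : ℝ) < ∑ i ∈ Finset.range m, Z i ω} := by
    have h1 : μ.real {ω | ∑ i ∈ Finset.range m, Z (m + i) ω ≤ 3 * M * √(m : ℝ)} =
        μ.real {ω | ∑ i ∈ Finset.range m, Z i ω ≤ 3 * M * √(m : ℝ)} :=
      congrArg ENNReal.toReal (hshift.measure_mem_eq hU)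
    have h2 : NullMeasurableSet {ω | 3 * M * √(m : ℝ) < ∑ i ∈ Finset.range m, Z i ω} μ :=
      nullMeasurableSet_lt aemeasurable_const (Finset.aemeasurable_fun_sum _ fun i _ => hmeas i)
    have h3 : {ω | ∑ i ∈ Finset.range m, Z i ω ≤ 3 * M * √(m : ℝ)} =
        {ω | 3 * M * √(m : ℝ) < ∑ i ∈ Finset.range m, Z i ω}ᶜ := by
      ext ω; simp
    rw [h1, h3, probReal_compl_eq_one_sub₀ h2]
  rw [← hTlaw, ← hS, ← hT, measureReal_def, measureReal_def, measureReal_def, ← ENNReal.toReal_mul,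
    ← hmul]
  refine ENNReal.toReal_mono (measure_ne_top _ _) (measure_mono ?_)
  rw [hS, hT]
  intro ω hω
  simp only [Set.mem_ofPred_eq, Finset.mem_Icc, Set.mem_inter_iff] at hω ⊢
  refine ⟨fun k hk => hω k ⟨hk.1, by omega⟩, ?_⟩
  have h1 := abs_le.1 (hω m ⟨hm, by omega⟩)
  have h2 := abs_le.1 (hω (2 * m) ⟨by omega, le_rfl⟩)
  -- The increment is at most `M * √(2 m) + M * √m`; this crude bound yields the constant `3`.
  have h3 : √((2 * m : ℕ) : ℝ) ≤ 2 * √(m : ℝ) := by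
    rw [Real.sqrt_le_left (by positivity), mul_pow, Real.sq_sqrt (by positivity)]
    push_cast
    linarith [Nat.cast_nonneg (α := ℝ) m]
  have h4 : ∑ i ∈ Finset.range (2 * m), Z i ω =
      ∑ i ∈ Finset.range m, Z i ω + ∑ i ∈ Finset.range m, Z (m + i) ω := by
    rw [two_mul, Finset.sum_range_add]
  have h5 := mul_le_mul_of_nonneg_left h3 hM
  linarith [h1.1, h2.2]

/-- The partial sums of centred i.i.d. random variables with positive variance are not bounded
by a multiple of `√k`. -/
theorem tendsto_measureReal_forall_abs_sum_le {Ω : Type*} [MeasurableSpace Ω]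
    {μ : Measure Ω} [IsProbabilityMeasure μ] {Z : ℕ → Ω → ℝ} (hind : iIndepFun Z μ)
    (hid : ∀ i, IdentDistrib (Z i) (Z 0) μ μ) (hL : MemLp (Z 0) 2 μ) (hmean : ∫ ω, Z 0 ω ∂μ = 0)
    (hvar : 0 < variance (Z 0) μ) {M : ℝ} (hM : 0 ≤ M) :
    Tendsto (fun n : ℕ => μ.real
      {ω | ∀ k ∈ Finset.Icc 1 n, |∑ i ∈ Finset.range k, Z i ω| ≤ M * √(k : ℝ)}) atTop (𝓝 0) := by
  set p : ℕ → ℝ := fun n => μ.real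
      {ω | ∀ k ∈ Finset.Icc 1 n, |∑ i ∈ Finset.range k, Z i ω| ≤ M * √(k : ℝ)} with hp
  have hanti : Antitone p := fun m n hmn => measureReal_mono fun ω hω k hk =>
    hω k (Finset.Icc_subset_Icc_right hmn hk)
  have hp0 n : 0 ≤ p n := measureReal_nonneg
  have hlim := tendsto_atTop_ciInf hanti ⟨0, by rintro _ ⟨n, rfl⟩; exact hp0 n⟩
  set L := ⨅ n, p n
  have hL0 : 0 ≤ L := le_ciInf hp0
  obtain ⟨δ, hδ, hev⟩ :=
    exists_pos_eventually_le_measureReal_sum_gt hind hid hL hmean hvar (3 * M)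
  -- Limit of `p (2 * m) ≤ p m * (1 - δ)`; as `δ > 0`, it forces `L = 0`.
  have hle : L ≤ L * (1 - δ) := by
    refine le_of_tendsto_of_tendsto
      (hlim.comp (tendsto_id.const_mul_atTop' (r := 2) (by norm_num))) (hlim.mul_const (1 - δ)) ?_
    filter_upwards [hev, eventually_ge_atTop 1] with m hm hm1
    exact (measureReal_forall_abs_sum_le_two_mul hind hid hM hm1).trans
      (mul_le_mul_of_nonneg_left (by linarith) (hp0 m))
  have : L = 0 := by nlinarith
  rwa [this] at hlim

/-! ### Deviation of the norm from `√k`. -/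

/-- The distance of the norm of `(y_0, …, y_{k-1})` from `√k`. -/
noncomputable def normDeviation (y : ℕ → ℝ) (k : ℕ) : ℝ :=
  |√(∑ i ∈ Finset.range k, y i ^ 2) - √(k : ℝ)|

theorem normDeviation_mul_sqrt_le (y : ℕ → ℝ) (k : ℕ) :
    normDeviation y k * √(k : ℝ) ≤ |∑ i ∈ Finset.range k, (y i ^ 2 - 1)| := by
  have h0 : 0 ≤ ∑ i ∈ Finset.range k, y i ^ 2 := Finset.sum_nonneg fun i _ => sq_nonneg _
  have h1 : ∑ i ∈ Finset.range k, (y i ^ 2 - 1) = (√(∑ i ∈ Finset.range k, y i ^ 2) - √(k : ℝ)) *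
      (√(∑ i ∈ Finset.range k, y i ^ 2) + √(k : ℝ)) := by
    rw [← mul_comm, ← sq_sub_sq, Real.sq_sqrt h0, Real.sq_sqrt (Nat.cast_nonneg k)]
    simp
  rw [h1, abs_mul, normDeviation]
  refine mul_le_mul_of_nonneg_left ?_ (abs_nonneg _)
  exact (le_add_of_nonneg_left (Real.sqrt_nonneg _)).trans (le_abs_self _)

/-- In the difference of squares, the sum of the roots is at most `t + 2 * √k`, hence at most `(t +
2) * √k` because `√k ≥ 1`. -/
theorem abs_sum_le_of_normDeviation_le {y : ℕ → ℝ} {k : ℕ} (hk : 1 ≤ k) {t : ℝ}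
    (h : normDeviation y k ≤ t) :
    |∑ i ∈ Finset.range k, (y i ^ 2 - 1)| ≤ t * (t + 2) * √(k : ℝ) := by
  have h0 : 0 ≤ ∑ i ∈ Finset.range k, y i ^ 2 := Finset.sum_nonneg fun i _ => sq_nonneg _
  have ht : 0 ≤ t := (abs_nonneg _).trans h
  have h1 : ∑ i ∈ Finset.range k, (y i ^ 2 - 1) = (√(∑ i ∈ Finset.range k, y i ^ 2) - √(k : ℝ)) *
      (√(∑ i ∈ Finset.range k, y i ^ 2) + √(k : ℝ)) := by
    rw [← mul_comm, ← sq_sub_sq, Real.sq_sqrt h0, Real.sq_sqrt (Nat.cast_nonneg k)]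
    simp
  have hk1 : 1 ≤ √(k : ℝ) := Real.one_le_sqrt.2 (by exact_mod_cast hk)
  have h2 := (abs_le.1 h).2
  rw [h1, abs_mul, mul_assoc]
  refine mul_le_mul h ?_ (abs_nonneg _) ht
  rw [abs_of_nonneg (by positivity)]
  nlinarith [mul_nonneg ht (sub_nonneg.2 hk1)]

theorem measurable_normDeviation (k : ℕ) : Measurable fun y : ℕ → ℝ => normDeviation y k := by
  unfold normDeviation
  fun_prop

section
variable {Ω : Type*} [MeasurableSpace Ω] {μ : Measure Ω} [IsProbabilityMeasure μ] {Y : ℕ → Ω → ℝ}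

theorem measureReal_normDeviation_ge_le (hind : iIndepFun Y μ)
    (hid : ∀ i, IdentDistrib (Y i) (Y 0) μ μ) (hY : ∫ ω, Y 0 ω ^ 2 ∂μ = 1)
    (hL : MemLp (fun ω => Y 0 ω ^ 2) 2 μ) {t : ℝ} (ht : 0 < t) {k : ℕ} (hk : 1 ≤ k) :
    μ.real {ω | t ≤ normDeviation (fun i => Y i ω) k} ≤
      variance (fun ω => Y 0 ω ^ 2) μ / t ^ 2 := by
  have hk0 : (0 : ℝ) < k := by exact_mod_cast hk
  have hid2 i : IdentDistrib (fun ω => Y i ω ^ 2) (fun ω => Y 0 ω ^ 2) μ μ :=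
    (hid i).comp (u := fun x : ℝ => x ^ 2) (by fun_prop)
  have hL2 i : MemLp (fun ω => Y i ω ^ 2) 2 μ := (hid2 i).memLp_iff.2 hL
  have hind2 : iIndepFun (fun i ω => Y i ω ^ 2) μ :=
    hind.comp (fun _ x => x ^ 2) fun _ => by fun_prop
  have hvar : variance (∑ i ∈ Finset.range k, fun ω => Y i ω ^ 2) μ =
      k * variance (fun ω => Y 0 ω ^ 2) μ := by
    rw [IndepFun.variance_sum (fun i _ => hL2 i) fun i _ j _ hij => hind2.indepFun hij,
      Finset.sum_congr rfl fun i _ => (hid2 i).variance_eq]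
    simp
  have hmean : ∫ ω, (∑ i ∈ Finset.range k, fun ω => Y i ω ^ 2) ω ∂μ = k := by
    simp only [Finset.sum_apply]
    rw [integral_finsetSum _ fun i _ => (hL2 i).integrable one_le_two,
      Finset.sum_congr rfl fun i _ => (hid2 i).integral_eq, hY]
    simp
  -- At threshold `t * √k` the factor `k` of the variance cancels, so the bound is free of `k`.
  have hc := meas_ge_le_variance_div_sq (memLp_finsetSum' (Finset.range k) fun i _ => hL2 i)
    (c := t * √(k : ℝ)) (by positivity)
  rw [hvar, hmean, mul_pow, Real.sq_sqrt hk0.le, mul_comm (t ^ 2),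
    mul_div_mul_left _ _ hk0.ne'] at hc
  refine ENNReal.toReal_le_of_le_ofReal (div_nonneg (variance_nonneg _ _) (sq_nonneg t))
    ((measure_mono fun ω hω => ?_).trans hc)
  have h := normDeviation_mul_sqrt_le (fun i => Y i ω) k
  have hω' : t ≤ normDeviation (fun i => Y i ω) k := hω
  simp only [Set.mem_ofPred_eq, Finset.sum_apply]
  calc t * √(k : ℝ) ≤ _ := mul_le_mul_of_nonneg_right hω' (Real.sqrt_nonneg _)
    _ ≤ _ := h
    _ = _ := by simp

theorem tendsto_measureReal_maxUpTo_normDeviation (hind : iIndepFun Y μ)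
    (hid : ∀ i, IdentDistrib (Y i) (Y 0) μ μ) (hY : ∫ ω, Y 0 ω ^ 2 ∂μ = 1)
    (hL : MemLp (fun ω => Y 0 ω ^ 2) 2 μ) (hvar : 0 < variance (fun ω => Y 0 ω ^ 2) μ)
    {t : ℝ} (ht : 0 < t) :
    Tendsto (fun n : ℕ => μ.real {ω | t ≤ maxUpTo n (normDeviation fun i => Y i ω)})
      atTop (𝓝 1) := by
  have h0 := tendsto_measureReal_forall_abs_sum_le (Z := fun i ω => Y i ω ^ 2 - 1)
    (hind.comp (fun _ x => x ^ 2 - 1) fun _ => by fun_prop)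
    (fun i => (hid i).comp (u := fun x : ℝ => x ^ 2 - 1) (by fun_prop))
    (hL.sub (memLp_const 1))
    (by rw [integral_sub (hL.integrable one_le_two) (integrable_const 1), hY]; simp)
    (by rwa [variance_sub_const hL.aestronglyMeasurable]) (M := t * (t + 2)) (by positivity)
  have h1 := h0.const_sub 1
  rw [sub_zero] at h1
  refine tendsto_of_tendsto_of_tendsto_of_le_of_le' h1
    tendsto_const_nhds ?_ (Eventually.of_forall fun n => measureReal_le_one)
  filter_upwards [eventually_ge_atTop 1] with n hn
  rw [sub_le_iff_le_add]
  refine (probReal_univ (μ := μ)).ge.trans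
    ((measureReal_mono fun ω _ => ?_).trans (measureReal_union_le _ _))
  by_cases h : t ≤ maxUpTo n (normDeviation fun i => Y i ω)
  · exact Or.inl h
  · refine Or.inr fun k hk => abs_sum_le_of_normDeviation_le (Finset.mem_Icc.1 hk).1 ?_
    by_contra! hlt
    exact h ((le_maxUpTo_iff hn _ _).2 ⟨k, hk, hlt.le⟩)

end

/-! ### Orthonormal systems. -/

/-- Pythagoras, by induction. The index map `u` covers both the fixed directions and the random ones
when no collision occurs. -/
theorem norm_sum_smul_of_injOn {𝕜 H : Type*} [RCLike 𝕜] [NormedAddCommGroup H]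
    [InnerProductSpace 𝕜 H] {ι : Type*} {e : ι → H} (he : Orthonormal 𝕜 e) (y : ℕ → ℝ)
    (u : ℕ → ι) (k : ℕ) (hu : Set.InjOn u (Set.Iio k)) :
    ‖∑ i ∈ Finset.range k, (y i : 𝕜) • e (u i)‖ = √(∑ i ∈ Finset.range k, y i ^ 2) := by
  suffices h : ‖∑ i ∈ Finset.range k, (y i : 𝕜) • e (u i)‖ ^ 2 =
      ∑ i ∈ Finset.range k, y i ^ 2 by
    rw [← h, Real.sqrt_sq (norm_nonneg _)]
  induction k with
  | zero => simp
  | succ k ih =>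
    have h0 : inner 𝕜 (∑ i ∈ Finset.range k, (y i : 𝕜) • e (u i)) ((y k : 𝕜) • e (u k)) = 0 := by
      rw [sum_inner]
      refine Finset.sum_eq_zero fun i hi => ?_
      have hik := Finset.mem_range.1 hi
      have hne : u i ≠ u k := fun h =>
        hik.ne (hu (Set.mem_Iio.2 (hik.trans k.lt_succ_self)) (Set.mem_Iio.2 k.lt_succ_self) h)
      rw [inner_smul_left, inner_smul_right, he.inner_eq_zero hne, mul_zero, mul_zero]
    rw [Finset.sum_range_succ, Finset.sum_range_succ, sq,
      norm_add_sq_eq_norm_sq_add_norm_sq_of_inner_eq_zero _ _ h0, ← sq,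
      ih (hu.mono (Set.Iio_subset_Iio k.le_succ)), norm_smul, he.norm_eq_one, mul_one,
      RCLike.norm_ofReal, abs_mul_abs_self, sq (y k)]

theorem exists_orthonormal_nat {𝕜 H : Type*} [RCLike 𝕜] [NormedAddCommGroup H]
    [InnerProductSpace 𝕜 H] (h : ¬ FiniteDimensional 𝕜 H) : ∃ e : ℕ → H, Orthonormal 𝕜 e := by
  have b := Module.Basis.ofVectorSpace 𝕜 H
  have : Infinite (Module.Basis.ofVectorSpaceIndex 𝕜 H) := by
    by_contra hf
    rw [not_infinite_iff_finite] at hf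
    exact h (Module.Finite.of_basis b)
  exact ⟨_, InnerProductSpace.gramSchmidtNormed_orthonormal
    (b.linearIndependent.comp _ (Infinite.natEmbedding _).injective)⟩

theorem MeasureTheory.MeasurePreserving.identDistrib_comp {α β γ : Type*} [MeasurableSpace α]
    [MeasurableSpace β] [MeasurableSpace γ] {μ : Measure α} {ν : Measure β} {f : α → β}
    (hf : MeasurePreserving f μ ν) {g : β → γ} (hg : Measurable g) :
    IdentDistrib (fun x => g (f x)) g μ ν where
  aemeasurable_fst := (hg.comp hf.measurable).aemeasurable
  aemeasurable_snd := hg.aemeasurable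
  map_eq := by
    rw [← hf.map_eq, Measure.map_map hg hf.measurable]
    rfl

/-! ### Moments of the squared Gaussian. -/

theorem memLp_sq_gaussianReal : MemLp (fun x : ℝ => x ^ 2) 2 (gaussianReal 0 1) := by
  have h := (memLp_id_gaussianReal (μ := 0) (v := 1) 4).norm_rpow_div (q := 2)
  have h4 : ((4 : NNReal) : ENNReal) / 2 = 2 := by
    rw [ENNReal.coe_ofNat]
    exact ((ENNReal.eq_div_iff two_ne_zero ENNReal.ofNat_ne_top).2 (by norm_num)).symm
  rw [h4] at h
  simpa using h

theorem integral_sq_gaussianReal : ∫ x : ℝ, x ^ 2 ∂gaussianReal 0 1 = 1 := by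
  have h := variance_eq_integral (μ := gaussianReal 0 1) (X := id) aemeasurable_id
  simpa [variance_id_gaussianReal, integral_id_gaussianReal] using h.symm

/-- Zero variance would make `x ^ 2` constant Lebesgue-almost everywhere, hence everywhere by
continuity. -/
theorem variance_sq_gaussianReal_pos : 0 < variance (fun x : ℝ => x ^ 2) (gaussianReal 0 1) := by
  refine (variance_nonneg _ _).lt_of_ne' fun h => ?_
  have hL : MemLp (fun x : ℝ => x ^ 2) 2 (gaussianReal 0 1) := memLp_sq_gaussianReal
  have hae := (gaussianReal_absolutelyContinuous' 0 one_ne_zero).ae_le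
    (ae_eq_integral_of_variance_eq_zero hL h)
  set c := ∫ x : ℝ, x ^ 2 ∂gaussianReal 0 1
  have hc : (fun x : ℝ => x ^ 2) = fun _ => c :=
    (Continuous.ae_eq_iff_eq volume (by fun_prop) continuous_const).1 hae
  have h0 := congrFun hc 0
  have h1 := congrFun hc 1
  norm_num at h0 h1
  linarith

/-! ### Random directions and their collisions. -/

/-- The law of a standard Gaussian together with an independent uniform index below `N`. -/
noncomputable def gaussianIndexLaw (N : ℕ) : Measure (ℝ × Fin N) :=
  (gaussianReal 0 1).prod (uniformOn Set.univ)

instance (N : ℕ) [NeZero N] : IsProbabilityMeasure (uniformOn (Set.univ : Set (Fin N))) :=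
  isProbabilityMeasure_uniformOn Set.finite_univ Set.univ_nonempty

instance (N : ℕ) [NeZero N] : IsProbabilityMeasure (gaussianIndexLaw N) := by
  unfold gaussianIndexLaw
  infer_instance

theorem measure_index_eq_index (N : ℕ) [NeZero N] {i j : ℕ} (hij : i ≠ j) :
    (Measure.infinitePi fun _ : ℕ => gaussianIndexLaw N) {ω | (ω i).2 = (ω j).2} =
      (N : ENNReal)⁻¹ := by
  have h1 : MeasurePreserving (fun ω : ℕ → ℝ × Fin N => (ω i, ω j))
      (Measure.infinitePi fun _ : ℕ => gaussianIndexLaw N)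
      ((gaussianIndexLaw N).prod (gaussianIndexLaw N)) :=
    ⟨by fun_prop, Measure.infinitePi_map_eval_prod hij⟩
  have h2 : MeasurePreserving Prod.snd (gaussianIndexLaw N) (uniformOn Set.univ) :=
    measurePreserving_snd
  have h3 := (h2.prod h2).comp h1
  have hms : MeasurableSet {p : Fin N × Fin N | p.1 = p.2} := .of_discrete
  have h4 := h3.measure_preimage hms.nullMeasurableSet
  refine h4.trans ?_
  rw [Measure.prod_apply hms]
  have h5 x : uniformOn Set.univ (Prod.mk x ⁻¹' {p : Fin N × Fin N | p.1 = p.2}) =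
      (N : ENNReal)⁻¹ := by
    have : Prod.mk x ⁻¹' {p : Fin N × Fin N | p.1 = p.2} = {x} := by
      ext y; simp [eq_comm]
    rw [this, uniformOn_univ, Measure.count_singleton, Fintype.card_fin, one_div]
  rw [lintegral_congr h5]
  simp

/-- Birthday bound: at most `n ^ 2` ordered pairs, each colliding with probability `1 / N`. -/
theorem measureReal_not_injOn_index_le (N : ℕ) [NeZero N] (n : ℕ) :
    (Measure.infinitePi fun _ : ℕ => gaussianIndexLaw N).real
      {ω | ¬ Set.InjOn (fun i => (ω i).2) (Set.Iio n)} ≤ (n : ℝ) ^ 2 / N := by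
  have hsub : {ω : ℕ → ℝ × Fin N | ¬ Set.InjOn (fun i => (ω i).2) (Set.Iio n)} ⊆
      ⋃ p ∈ (Finset.range n).offDiag, {ω | (ω p.1).2 = (ω p.2).2} := by
    intro ω hω
    simp only [Set.InjOn, Set.mem_ofPred_eq, Set.mem_Iio] at hω
    push Not at hω
    obtain ⟨i, hi, j, hj, hij, hne⟩ := hω
    simp only [Set.mem_iUnion]
    exact ⟨(i, j), by simp [hi, hj, hne], hij⟩
  refine (measureReal_mono hsub (measure_ne_top _ _)).trans ((measureReal_biUnion_finset_le _ _).trans ?_)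
  have h1 : ∀ p ∈ (Finset.range n).offDiag, (Measure.infinitePi fun _ : ℕ =>
      gaussianIndexLaw N).real {ω | (ω p.1).2 = (ω p.2).2} = (N : ℝ)⁻¹ := fun p hp => by
    rw [measureReal_def, measure_index_eq_index N (Finset.mem_offDiag.1 hp).2.2]
    simp
  rw [Finset.sum_congr rfl h1, Finset.sum_const, nsmul_eq_mul, div_eq_mul_inv]
  refine mul_le_mul_of_nonneg_right ?_ (by positivity)
  have : (Finset.range n).offDiag.card ≤ n ^ 2 := by
    rw [Finset.offDiag_card, Finset.card_range, sq]
    exact Nat.sub_le _ _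
  exact_mod_cast this

theorem measurableSet_le_maxUpTo_normDeviation {n : ℕ} (hn : 1 ≤ n) (s : ℝ) :
    MeasurableSet {y : ℕ → ℝ | s ≤ maxUpTo n (normDeviation y)} := by
  have : {y : ℕ → ℝ | s ≤ maxUpTo n (normDeviation y)} =
      ⋃ k ∈ Finset.Icc 1 n, {y | s ≤ normDeviation y k} := by
    ext y
    simp [le_maxUpTo_iff hn]
  rw [this]
  exact Finset.measurableSet_biUnion _ fun k _ =>
    measurableSet_le measurable_const (measurable_normDeviation k)

/-! ### The i.i.d. symmetric counterexample. -/

theorem exists_iid_symmetric_measureReal_maxUpTo_gt {𝕜 H : Type*} [RCLike 𝕜]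
    [NormedAddCommGroup H] [InnerProductSpace 𝕜 H] [MeasurableSpace H] [BorelSpace H]
    (hH : ¬ FiniteDimensional 𝕜 H) (C₁ C₂ : ℝ) :
    ∃ (Ω : Type) (_ : MeasurableSpace Ω) (μ : Measure Ω) (_ : IsProbabilityMeasure μ)
      (X : ℕ → Ω → H) (n : ℕ) (a : ℕ → ℝ) (t : ℝ),
      (∀ i, StronglyMeasurable (X i)) ∧ iIndepFun X μ ∧
      (∀ i, IdentDistrib (X i) (X 0) μ μ) ∧ (∀ i, IsSymmetricRV (X i) μ) ∧
      1 ≤ n ∧ 0 < t ∧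
      C₂ * maxUpTo n (fun k => μ.real {ω | t < |‖partialSum X k ω‖ - a k|})
        < μ.real {ω | C₁ * t < maxUpTo n fun k => |‖partialSum X k ω‖ - a k|} := by
  obtain ⟨e, he⟩ := exists_orthonormal_nat hH
  -- the canonical Gaussian sequence
  let G : Measure (ℕ → ℝ) := Measure.infinitePi fun _ => gaussianReal 0 1
  have hGlaw (i : ℕ) : IdentDistrib (fun w : ℕ → ℝ => w i) id G (gaussianReal 0 1) :=
    (measurePreserving_eval_infinitePi (fun _ : ℕ => gaussianReal 0 1) i).identDistrib_comp
      measurable_id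
  have hGind : iIndepFun (fun i (w : ℕ → ℝ) => w i) G :=
    iIndepFun_infinitePi (X := fun _ x => x) fun _ => measurable_id
  have hGsq : IdentDistrib (fun w : ℕ → ℝ => w 0 ^ 2) (fun x => x ^ 2) G (gaussianReal 0 1) :=
    (hGlaw 0).comp (u := fun x : ℝ => x ^ 2) (by fun_prop)
  have hGid i := (hGlaw i).trans (hGlaw 0).symm
  have hG1 : ∫ w : ℕ → ℝ, w 0 ^ 2 ∂G = 1 := hGsq.integral_eq.trans integral_sq_gaussianReal
  have hGL : MemLp (fun w : ℕ → ℝ => w 0 ^ 2) 2 G := hGsq.memLp_iff.2 memLp_sq_gaussianReal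
  have hGvar : 0 < variance (fun w : ℕ → ℝ => w 0 ^ 2) G :=
    hGsq.variance_eq ▸ variance_sq_gaussianReal_pos
  set V := variance (fun w : ℕ → ℝ => w 0 ^ 2) G
  -- the choice of the parameters
  set ε : ℝ := 1 / (4 * (|C₂| + 1)) with hε
  have hε0 : 0 < ε := by positivity
  -- One `ε` pays for Chebyshev, the other for collisions; `1 / 2` will bound the probability of the
  -- maximum from below, as `3 / 4 - ε`.
  have hεC : |C₂| * (2 * ε) < 1 / 2 := by
    rw [hε, show |C₂| * (2 * (1 / (4 * (|C₂| + 1)))) = (|C₂| / (|C₂| + 1)) * (1 / 2) by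
      field_simp; norm_num]
    have : |C₂| / (|C₂| + 1) < 1 := (div_lt_one (by positivity)).2 (lt_add_one _)
    linarith
  have hε4 : ε ≤ 1 / 4 := by
    rw [hε]
    exact one_div_le_one_div_of_le (by norm_num) (by linarith [abs_nonneg C₂])
  set t : ℝ := V / ε + 1 with ht
  have hVε : 0 < V / ε := div_pos hGvar hε0
  have ht0 : 0 < t := by positivity
  have hVt : V / t ^ 2 ≤ ε := by
    rw [div_le_iff₀ (by positivity), mul_comm, ← div_le_iff₀ hε0]
    nlinarith
  -- The `+ 1` turns a weak inequality at `s` into a strict one at `C₁ * t`.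
  set s : ℝ := |C₁| * t + 1 with hs
  have hs0 : 0 < s := by positivity
  have hsC : C₁ * t < s := by
    have := mul_le_mul_of_nonneg_right (le_abs_self C₁) ht0.le
    linarith
  obtain ⟨n, hn1, hn⟩ := ((eventually_ge_atTop 1).and
    ((tendsto_measureReal_maxUpTo_normDeviation hGind hGid hG1 hGL hGvar hs0).eventually
      (lt_mem_nhds (show (3 / 4 : ℝ) < 1 by norm_num)))).exists
  -- `N` depends on `n`, while `n` comes from the Gaussian sequence alone, so there is no
  -- circularity.
  obtain ⟨N, hN⟩ := exists_nat_gt ((n : ℝ) ^ 2 / ε)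
  have hNpos : (0 : ℝ) < N := lt_of_le_of_lt (by positivity) hN
  have hN0 : NeZero N := ⟨by rintro rfl; simp at hNpos⟩
  have hNε : (n : ℝ) ^ 2 / N ≤ ε := by
    rw [div_le_iff₀ hNpos, mul_comm, ← div_le_iff₀ hε0]
    exact hN.le
  -- the random vectors
  let P : Measure (ℕ → ℝ × Fin N) := Measure.infinitePi fun _ => gaussianIndexLaw N
  let g : ℝ × Fin N → H := fun p => (p.1 : 𝕜) • e p.2
  have hg : StronglyMeasurable g :=
    (RCLike.measurable_ofReal.comp measurable_fst).stronglyMeasurable.smul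
      ((StronglyMeasurable.of_discrete (f := fun u : Fin N => e u)).comp_measurable measurable_snd)
  have hPeval i : MeasurePreserving (fun ω : ℕ → ℝ × Fin N => ω i) P (gaussianIndexLaw N) :=
    measurePreserving_eval_infinitePi (fun _ : ℕ => gaussianIndexLaw N) i
  have hXlaw i : IdentDistrib (fun ω : ℕ → ℝ × Fin N => g (ω i)) g P (gaussianIndexLaw N) :=
    (hPeval i).identDistrib_comp hg.measurable
  have hflip : MeasurePreserving (Prod.map (fun x : ℝ => -x) id)
      (gaussianIndexLaw N) (gaussianIndexLaw N) :=
    MeasurePreserving.prod ⟨measurable_neg, by rw [gaussianReal_map_neg, neg_zero]⟩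
      (MeasurePreserving.id _)
  have hnegg : (fun p => -g p) = g ∘ Prod.map (fun x : ℝ => -x) id := by
    ext p
    simp [g]
  have hsymm : IdentDistrib g (fun p => -g p) (gaussianIndexLaw N) (gaussianIndexLaw N) := by
    rw [hnegg]
    exact (hflip.identDistrib_comp hg.measurable).symm
  -- the coefficients have the law of the canonical Gaussian sequence
  have hYlaw i : IdentDistrib (fun ω : ℕ → ℝ × Fin N => (ω i).1) id P (gaussianReal 0 1) :=
    ((measurePreserving_fst (μ := gaussianReal 0 1)
      (ν := uniformOn (Set.univ : Set (Fin N)))).comp (hPeval i)).identDistrib_comp measurable_id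
  have hYind : iIndepFun (fun i (ω : ℕ → ℝ × Fin N) => (ω i).1) P :=
    iIndepFun_infinitePi (X := fun _ (p : ℝ × Fin N) => p.1) fun _ => measurable_fst
  -- Equality of the laws of whole sequences is needed, since the maximum involves many partial
  -- sums.
  have hYG : IdentDistrib (fun (ω : ℕ → ℝ × Fin N) i => (ω i).1) (fun w i => w i) P G :=
    IdentDistrib.pi (fun i => (hYlaw i).trans (hGlaw i).symm) hYind hGind
  set D : Set (ℕ → ℝ × Fin N) := {ω | ¬ Set.InjOn (fun i => (ω i).2) (Set.Iio n)}
  have hD : P.real D ≤ ε := (measureReal_not_injOn_index_le N n).trans hNε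
  have hdev (ω : ℕ → ℝ × Fin N) (hω : ω ∉ D) (k : ℕ) (hk : k ≤ n) :
      |‖partialSum (fun i ω => g (ω i)) k ω‖ - √(k : ℝ)| =
        normDeviation (fun i => (ω i).1) k := by
    have hinj : Set.InjOn (fun i => (ω i).2) (Set.Iio n) := not_not.1 hω
    have := norm_sum_smul_of_injOn (𝕜 := 𝕜) (he.comp (fun u : Fin N => (u : ℕ)) Fin.val_injective)
      (fun i => (ω i).1) (fun i => (ω i).2) k (hinj.mono (Set.Iio_subset_Iio hk))
    rw [normDeviation, ← this]
    rfl
  refine ⟨ℕ → ℝ × Fin N, inferInstance, P, inferInstance, fun i ω => g (ω i), n,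
    fun k => √(k : ℝ), t, fun i => hg.comp_measurable (measurable_pi_apply i),
    iIndepFun_infinitePi (X := fun _ => g) fun _ => hg.measurable,
    fun i => (hXlaw i).trans (hXlaw 0).symm, fun i => ?_, hn1, ht0, ?_⟩
  · exact ((hXlaw i).trans hsymm).trans ((hXlaw i).comp measurable_neg).symm
  have hsmall : ∀ k ∈ Finset.Icc 1 n,
      P.real {ω | t < |‖partialSum (fun i ω => g (ω i)) k ω‖ - √(k : ℝ)|} ≤ 2 * ε := by
    intro k hk
    obtain ⟨hk1, hkn⟩ := Finset.mem_Icc.1 hk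
    have h1 : P.real {ω | t ≤ normDeviation (fun i => (ω i).1) k} ≤ ε := by
      have h2 : P.real {ω | t ≤ normDeviation (fun i => (ω i).1) k} =
          G.real {w | t ≤ normDeviation w k} :=
        congrArg ENNReal.toReal (hYG.measure_mem_eq (s := {w | t ≤ normDeviation w k})
          (measurableSet_le measurable_const (measurable_normDeviation k)))
      rw [h2]
      exact (measureReal_normDeviation_ge_le hGind hGid hG1 hGL ht0 hk1).trans hVt
    have h3 : {ω | t < |‖partialSum (fun i ω => g (ω i)) k ω‖ - √(k : ℝ)|} ⊆
        {ω | t ≤ normDeviation (fun i => (ω i).1) k} ∪ D := by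
      intro ω hω
      by_cases hωD : ω ∈ D
      · exact Or.inr hωD
      · exact Or.inl ((le_of_lt hω).trans_eq (hdev ω hωD k hkn))
    linarith [(measureReal_mono (μ := P) h3).trans (measureReal_union_le _ _)]
  have hlarge : 1 / 2 ≤ P.real {ω | C₁ * t < maxUpTo n fun k =>
      |‖partialSum (fun i ω => g (ω i)) k ω‖ - √(k : ℝ)|} := by
    have h2 : P.real {ω | s ≤ maxUpTo n (normDeviation fun i => (ω i).1)} =
        G.real {w | s ≤ maxUpTo n (normDeviation w)} :=
      congrArg ENNReal.toReal (hYG.measure_mem_eq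
        (measurableSet_le_maxUpTo_normDeviation hn1 s))
    have h3 : {ω : ℕ → ℝ × Fin N | s ≤ maxUpTo n (normDeviation fun i => (ω i).1)} ⊆
        {ω | C₁ * t < maxUpTo n fun k =>
          |‖partialSum (fun i ω => g (ω i)) k ω‖ - √(k : ℝ)|} ∪ D := by
      intro ω hω
      by_cases hωD : ω ∈ D
      · exact Or.inr hωD
      · obtain ⟨k, hk, hle⟩ := (le_maxUpTo_iff hn1 _ _).1 hω
        refine Or.inl ((lt_maxUpTo_iff hn1 _ _).2 ⟨k, hk, ?_⟩)
        rw [hdev ω hωD k (Finset.mem_Icc.1 hk).2]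
        exact hsC.trans_le hle
    have h4 := (measureReal_mono (μ := P) h3).trans (measureReal_union_le _ _)
    rw [h2] at h4
    have h5 : 3 / 4 < G.real {w | s ≤ maxUpTo n (normDeviation w)} := hn
    linarith
  refine lt_of_lt_of_le ?_ hlarge
  set q : ℕ → ℝ := fun k => P.real {ω | t < |‖partialSum (fun i ω => g (ω i)) k ω‖ - √(k : ℝ)|}
  -- Needed to replace `C₂`, possibly negative, by `|C₂|`.
  have hq0 : 0 ≤ maxUpTo n q := (le_maxUpTo_iff hn1 _ _).2
    ⟨1, Finset.mem_Icc.2 ⟨le_rfl, hn1⟩, measureReal_nonneg⟩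
  have hq : maxUpTo n q ≤ 2 * ε := by
    by_contra! h
    obtain ⟨k, hk, hlt⟩ := (lt_maxUpTo_iff hn1 _ _).1 h
    exact (hsmall k hk).not_gt hlt
  calc C₂ * maxUpTo n q ≤ |C₂| * maxUpTo n q := mul_le_mul_of_nonneg_right (le_abs_self _) hq0
    _ ≤ |C₂| * (2 * ε) := mul_le_mul_of_nonneg_left hq (abs_nonneg _)
    _ < 1 / 2 := hεC

theorem mainTheorem6 {𝕜 H : Type*} [RCLike 𝕜] [NormedAddCommGroup H] [InnerProductSpace 𝕜 H]
    [CompleteSpace H] [MeasurableSpace H] [BorelSpace H] :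
    -- the example with an orthonormal system
    (∀ {Ω : Type*} [MeasurableSpace Ω] (μ : Measure Ω) [IsProbabilityMeasure μ]
        (Y : ℕ → Ω → ℝ) (e : ℕ → H),
        iIndepFun Y μ → (∀ i, IdentDistrib (Y i) (Y 0) μ μ) →
        ∫ ω, Y 0 ω ^ 2 ∂μ = 1 → MemLp (fun ω => Y 0 ω ^ 2) 2 μ →
        Orthonormal 𝕜 e →
        (∀ t : ℝ, 0 < t → ∀ k : ℕ, 1 ≤ k →
          μ.real {ω | t ≤ |‖partialSum (fun i ω => (Y i ω : 𝕜) • e i) k ω‖ - √(k : ℝ)|}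
            ≤ variance (fun ω => Y 0 ω ^ 2) μ / t ^ 2) ∧
        (0 < variance (fun ω => Y 0 ω ^ 2) μ → ∀ t : ℝ, 0 < t →
          Tendsto
            (fun n : ℕ => μ.real {ω | t ≤ maxUpTo n fun k =>
              |‖partialSum (fun i ω => (Y i ω : 𝕜) • e i) k ω‖ - √(k : ℝ)|})
            atTop (𝓝 1))) ∧
    -- no maximal inequality for centered norms, whatever the constants
    (¬ FiniteDimensional 𝕜 H →
      ∀ C₁ C₂ : ℝ, ∃ (Ω : Type) (_ : MeasurableSpace Ω) (μ : Measure Ω) (_ : IsProbabilityMeasure μ)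
        (X : ℕ → Ω → H) (n : ℕ) (a : ℕ → ℝ) (t : ℝ),
        (∀ i, StronglyMeasurable (X i)) ∧ iIndepFun X μ ∧
        (∀ i, IdentDistrib (X i) (X 0) μ μ) ∧ (∀ i, IsSymmetricRV (X i) μ) ∧
        1 ≤ n ∧ 0 < t ∧
        C₂ * maxUpTo n (fun k => μ.real {ω | t < |‖partialSum X k ω‖ - a k|})
          < μ.real {ω | C₁ * t < maxUpTo n fun k => |‖partialSum X k ω‖ - a k|}) := by
  refine ⟨fun {Ω} _ μ _ Y e hind hid hY hL he => ?_,
    fun hH C₁ C₂ => exists_iid_symmetric_measureReal_maxUpTo_gt hH C₁ C₂⟩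
  have hdev (ω : Ω) : (fun k : ℕ =>
      |‖partialSum (fun i ω => (Y i ω : 𝕜) • e i) k ω‖ - √(k : ℝ)|) =
        normDeviation fun i => Y i ω := by
    ext k
    rw [normDeviation,
      ← norm_sum_smul_of_injOn he (fun i => Y i ω) id k Function.injective_id.injOn]
    rfl
  refine ⟨fun t ht k hk => ?_, fun hvar t ht => ?_⟩
  · simp only [fun ω => congrFun (hdev ω) k]
    exact measureReal_normDeviation_ge_le hind hid hY hL ht hk
  · simp only [hdev]
    exact tendsto_measureReal_maxUpTo_normDeviation hind hid hY hL hvar ht
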